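/- Fix a time horizon $T>0$ and a rate $\lambda>0$. Agents $i=1,2,\dots$ arrive at the successive times $W_1\le W_2\le\cdots$ of a Poisson process of rate $\lambda$; agent $i$ has initial valuation $V_i$, where the $V_i$ are i.i.d. with a distribution $F$ on $[1,h]$, $h>1$, and independent of the arrivals. Let $\xi:[0,T]\to[0,1]$ be continuous and non-increasing with $\xi(0)=1$ and $\xi(T)=0$, extended by $\xi(t)=0$ for $t>T$. A (deterministic) posted-price mechanism with price function $p:[0,T]\to\mathbb{R}_{\ge 0}$ sells a single item at price $p(W_i)$ to the first agent $i$ with $W_i\le T$ and $V_i\,\xi(W_i)\ge p(W_i)$ (and earns $0$ if there is no such agent). Write $\mathbb{E}_F[\mathcal{R}(\mathcal{M})]$ for the expected revenue of the mechanism $\mathcal{M}$, and $\mathbb{E}_F[\mathcal{R}(\mathcal{M}^\star)]$ for the supremum of the expected revenues of all posted-price mechanisms (whose prices may depend on $F$). A distribution $F$ on $[1,h]$ is MHR if it has a density $f$ on $\{x: F(x)<1\}$ and the hazard rate $f(x)/(1-F(x))$ is non-decreasing there (an atom at the largest value is allowed). Let $\mathcal{F}$ be the set of MHR distributions on $[1,h]$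 and $$\rho(\mathcal{M})=\inf_{F\in\mathcal{F}}\frac{\mathbb{E}_F[\mathcal{R}(\mathcal{M})]}{\mathbb{E}_F[\mathcal{R}(\mathcal{M}^\star)]}.$$ Let $\delta\in(1,h]$ and $\tau\in(0,T]$. The mechanism $\mathcal{M}_{\mathrm{PC}}$ partitions $[0,T]$ into the intervals $I_i=[(i-1)\tau,\min\{i\tau,T\}]$, $i=1,\dots,\lceil T/\tau\rceil$, and posts during $I_i$ the constant price $$\frac{h}{\delta^i}\,\xi(i\tau)\ \text{ if } i\le\lfloor\log_\delta h\rfloor,\qquad \xi(i\tau)\ \text{ if } \lfloor\log_\delta h\rfloor<i<\lceil T/\tau\rceil,\qquad \xi((i-1)\tau)\ \text{ if } \lfloor\log_\delta h\rfloor<i=\lceil T/\tau\rceil.$$ Theorem. If $\lambda\tau=(\lambda T)^{1-\epsilon}\ge 1-\ln(e-1)$ for some $0<\epsilon<1$, then $$\rho(\mathcal{M}_{\mathrm{PC}})\ \ge\ \frac{\xi\big((\lceil\log_\delta h\rceil+1)\,T^{1-\epsilon}\lambda^{-\epsilon}\big)\,(1-\epsilon)}{\delta e}.$$ -/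

import Mathlib

open MeasureTheory ProbabilityTheory Set

namespace PostedPrice

/-- A discount function on `[0, T]`: continuous, non-increasing, `ξ 0 = 1` and `ξ T = 0`. It is
extended by `0` after the deadline `T`. -/
structure IsDiscount (T : ℝ) (ξ : ℝ → ℝ) : Prop where
  continuousOn : ContinuousOn ξ (Icc 0 T)
  antitoneOn : AntitoneOn ξ (Icc 0 T)
  map_zero : ξ 0 = 1
  map_of_ge : ∀ t, T ≤ t → ξ t = 0

/-- The number of arrivals in the time interval `(s, t]`, where `W i` is the time of the `i`-th
arrival (counted from `0`). -/
noncomputable def arrivalCount {Ω : Type*} (W : ℕ → Ω → ℝ) (s t : ℝ) (ω : Ω) : ℕ∞ :=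
  Set.encard {i : ℕ | s < W i ω ∧ W i ω ≤ t}

/-- `W 0 ≤ W 1 ≤ …` are the successive arrival times of a Poisson process of rate `lam` on
`(0, ∞)`: the number of arrivals in `(s, t]` is Poisson distributed with parameter `lam * (t - s)`,
and the numbers of arrivals in successive intervals are independent. -/
structure IsPoissonArrivals {Ω : Type*} [MeasurableSpace Ω] (P : Measure Ω) (lam : ℝ)
    (W : ℕ → Ω → ℝ) : Prop where
  measurable : ∀ i, Measurable (W i)
  pos : ∀ᵐ ω ∂P, ∀ i, 0 < W i ω
  monotone : ∀ᵐ ω ∂P, Monotone fun i => W i ω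
  hasLaw : ∀ s t : ℝ, 0 ≤ s → s ≤ t →
    HasLaw (arrivalCount W s t)
      ((poissonMeasure (lam * (t - s)).toNNReal).map (fun n : ℕ => (n : ℕ∞))) P
  indep : ∀ u : ℕ → ℝ, 0 ≤ u 0 → Monotone u →
    iIndepFun (fun (j : ℕ) (ω : Ω) => arrivalCount W (u j) (u (j + 1)) ω) P

open Classical in
/-- The revenue of the posted-price mechanism with pricing strategy `p` when agent `i` arrives at
time `w i` and has initial valuation `v i`: the item is sold to the first agent who arrives by time
`T` and whose discounted valuation is at least the current price; with no such agent, the revenue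
is `0`. -/
noncomputable def revenue (T : ℝ) (ξ p : ℝ → ℝ) (w v : ℕ → ℝ) : ℝ :=
  if H : ∃ i, w i ≤ T ∧ p (w i) ≤ v i * ξ (w i) then p (w (Nat.find H)) else 0

/-- The expected revenue when the initial valuations are i.i.d. with law `F` and independent of the
arrival times `W`. -/
noncomputable def expectedRevenue {Ω : Type*} [MeasurableSpace Ω] (P : Measure Ω)
    (W : ℕ → Ω → ℝ) (T : ℝ) (ξ : ℝ → ℝ) (F : ProbabilityMeasure ℝ) (p : ℝ → ℝ) : ℝ :=
  ∫ x : Ω × (ℕ → ℝ), revenue T ξ p (fun i => W i x.1) x.2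
    ∂(P.prod (Measure.infinitePi fun _ : ℕ => (F : Measure ℝ)))

/-- The benchmark: the best expected revenue of a deterministic posted-price mechanism that knows
the distribution `F`. -/
noncomputable def benchmark {Ω : Type*} [MeasurableSpace Ω] (P : Measure Ω)
    (W : ℕ → Ω → ℝ) (T : ℝ) (ξ : ℝ → ℝ) (F : ProbabilityMeasure ℝ) : ℝ :=
  sSup {r : ℝ | ∃ p : ℝ → ℝ, Measurable p ∧ (∀ t ∈ Icc 0 T, 0 ≤ p t) ∧
    r = expectedRevenue P W T ξ F p}

/-- The competitive ratio of the mechanism with pricing strategy `p`, restricted to the set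
`𝓕` of distributions of the initial valuations. -/
noncomputable def competitiveRatio {Ω : Type*} [MeasurableSpace Ω] (P : Measure Ω)
    (W : ℕ → Ω → ℝ) (T : ℝ) (ξ : ℝ → ℝ) (𝓕 : Set (ProbabilityMeasure ℝ)) (p : ℝ → ℝ) : ℝ :=
  ⨅ F : 𝓕, expectedRevenue P W T ξ F p / benchmark P W T ξ F

/-- Monotone hazard rate: on the set of points where the distribution function is less than `1`,
the distribution has a density `f`, and `f x / (1 - F x)` is non-decreasing there. An atom at the
largest value is allowed, so point masses are included. -/
def IsMHR (F : ProbabilityMeasure ℝ) : Prop :=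
  ∃ f : ℝ → ℝ, Measurable f ∧ (∀ x, 0 ≤ f x) ∧
    (F : Measure ℝ).restrict {x | cdf (F : Measure ℝ) x < 1} =
      (volume.withDensity fun x => ENNReal.ofReal (f x)).restrict
        {x | cdf (F : Measure ℝ) x < 1} ∧
    MonotoneOn (fun x => f x / (1 - cdf (F : Measure ℝ) x)) {x | cdf (F : Measure ℝ) x < 1}

/-- The MHR distributions of initial valuations in `[1, h]`. -/
def mhrDistributions (h : ℝ) : Set (ProbabilityMeasure ℝ) :=
  {F | (F : Measure ℝ) (Icc 1 h) = 1 ∧ IsMHR F}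

/-- The price posted in the `i`-th interval `[(i - 1) τ, min (i τ) T]`, `1 ≤ i ≤ ⌈T / τ⌉`. -/
noncomputable def pcIntervalPrice (T τ h δ : ℝ) (ξ : ℝ → ℝ) (i : ℕ) : ℝ :=
  if i ≤ ⌊Real.logb δ h⌋₊ then h / δ ^ i * ξ (i * τ)
  else if i < ⌈T / τ⌉₊ then ξ (i * τ)
  else ξ ((i - 1 : ℝ) * τ)

/-- The pricing strategy of the piecewise-constant mechanism. Time `t > 0` lies in interval number
`⌈t / τ⌉`; time `0` lies in the first one. (At the common endpoint of two intervals the price of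
the earlier one is used; almost surely nobody arrives at these times.) -/
noncomputable def pcPrice (T τ h δ : ℝ) (ξ : ℝ → ℝ) (t : ℝ) : ℝ :=
  pcIntervalPrice T τ h δ ξ (max 1 ⌈t / τ⌉₊)

end PostedPrice

/-! ### Survival functions and the monotone hazard rate. -/

namespace PostedPrice

/-! Write `c = 1 - ε`, `l = log (λT)`, `S` for the survival function of `F`, `m = ⌊log_δ h⌋`. Both
revenues are compared with one quantile `X` of `F`, where `S` crosses `exp (-(l + s))`; the shift `s
≥ 0` is tuned at the end. MHR enters only through `S y ^ c ≤ S (c * y)`, the concavity of `log S`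
along rays (`IsMHR.rpow_survival_le`).

Upper bound: a sale earns at most `X` plus the excess over `X` of the buyer's valuation, so any
mechanism earns at most `X + λT · E (v - X)⁺` (`expectedRevenue_le`). Concavity gives an exponential
tail beyond `X` (`IsMHR.lintegral_excess_le`), and the benchmark is at most `X (1 + exp (-s) / (l +
s))`.

Lower bound: some level of the price grid lies above `c X / δ` and is still reached with probability
at least about `S (c X) ≥ exp (-c (l + s))` (`exists_pcLevel`). As `λτ = (λT) ^ c`, the mean number
of such agents in the corresponding interval is at least `exp (-c s)`. Undiscounted levels and `ξ`
both decrease, so a sale by the end of that interval earns at least `ξ ((m + 1) τ) · c X / δ`, and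
it occurs with probability at least `1 - exp (-exp (-c s))` (`le_expectedRevenue_pcPrice`).

What remains is the numerical claim `1 + exp (-s) / (l + s) ≤ e (1 - exp (-exp (-c s)))` for a
suitable `s` (`exists_one_add_exp_div_le`). If the discount factor in the bound is nonzero, at least
two intervals fit before `T`, so `2τ ≤ T`; this yields `l ≥ log 2` and `c l ≤ l - log 2`. -/

/-- A discrete Grönwall inequality. -/
lemma mul_exp_le_of_step {S : ℝ → ℝ} {a b r : ℝ} (hab : a ≤ b)
    (hS : ∀ x y, a ≤ x → x ≤ y → y ≤ b → S x * (1 + r * (y - x)) ≤ S y) :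
    S a * Real.exp (r * (b - a)) ≤ S b := by
  have hlim := (Real.tendsto_one_add_div_pow_exp (r * (b - a))).const_mul (S a)
  refine le_of_tendsto hlim ?_
  obtain ⟨N, hN⟩ := exists_nat_gt |r * (b - a)|
  filter_upwards [Filter.eventually_ge_atTop (N + 1)] with n hn
  have hnN : (N : ℝ) + 1 ≤ n := by exact_mod_cast hn
  have hn0 : (0 : ℝ) < n := by linarith [abs_nonneg (r * (b - a))]
  -- `r` may be negative; the induction multiplies inequalities by this factor, so `n` must be
  -- large.
  have hpos : 0 ≤ 1 + r * (b - a) / n := by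
    have h1 : -1 ≤ r * (b - a) / n := by
      rw [le_div_iff₀ hn0]
      linarith [neg_abs_le (r * (b - a))]
    linarith
  have key : ∀ i : ℕ, i ≤ n →
      S a * (1 + r * (b - a) / n) ^ i ≤ S (a + i * ((b - a) / n)) := by
    intro i
    induction i with
    | zero => intro _; simp
    | succ i ih =>
      intro hi
      have hd : 0 ≤ (b - a) / n := div_nonneg (by linarith) hn0.le
      have hi' : (i : ℝ) + 1 ≤ n := by exact_mod_cast hi
      have hle : a + ((i : ℝ) + 1) * ((b - a) / n) ≤ b := by
        have := mul_le_mul_of_nonneg_right hi' hd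
        rw [mul_div_cancel₀ _ hn0.ne'] at this
        linarith
      have hstep := hS (a + i * ((b - a) / n)) (a + ((i : ℝ) + 1) * ((b - a) / n))
        (by have : 0 ≤ (i : ℝ) * ((b - a) / n) := by positivity
            linarith) (by nlinarith) hle
      have h2 := mul_le_mul_of_nonneg_right (ih (by omega)) hpos
      push_cast
      calc S a * (1 + r * (b - a) / n) ^ (i + 1)
          = S a * (1 + r * (b - a) / n) ^ i * (1 + r * (b - a) / n) := by ring
        _ ≤ S (a + i * ((b - a) / n)) * (1 + r * (b - a) / n) := h2
        _ = S (a + i * ((b - a) / n)) * (1 + r * ((a + ((i : ℝ) + 1) * ((b - a) / n)) -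
              (a + i * ((b - a) / n)))) := by ring
        _ ≤ _ := hstep
  have := key n le_rfl
  rwa [mul_div_cancel₀ _ hn0.ne', add_sub_cancel] at this

/-- The survival function of a distribution on the real line. -/
noncomputable def survival (F : ProbabilityMeasure ℝ) (x : ℝ) : ℝ := 1 - cdf (F : Measure ℝ) x

lemma survival_eq_real_Ioi (F : ProbabilityMeasure ℝ) (x : ℝ) :
    survival F x = (F : Measure ℝ).real (Ioi x) := by
  rw [survival, cdf_eq_real, ← compl_Iic, probReal_compl_eq_one_sub measurableSet_Iic]

lemma survival_nonneg (F : ProbabilityMeasure ℝ) (x : ℝ) : 0 ≤ survival F x := by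
  rw [survival_eq_real_Ioi]; positivity

lemma survival_le_one (F : ProbabilityMeasure ℝ) (x : ℝ) : survival F x ≤ 1 := by
  rw [survival_eq_real_Ioi]; exact measureReal_le_one

lemma survival_antitone (F : ProbabilityMeasure ℝ) : Antitone (survival F) := fun x y hxy => by
  have := monotone_cdf (F : Measure ℝ) hxy
  simp only [survival]; linarith

lemma ofReal_survival_sub (F : ProbabilityMeasure ℝ) {f : ℝ → ℝ}
    (hF : (F : Measure ℝ).restrict {x | cdf (F : Measure ℝ) x < 1} =
      (volume.withDensity fun x => ENNReal.ofReal (f x)).restrict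
        {x | cdf (F : Measure ℝ) x < 1}) {x y : ℝ} (hy : 0 < survival F y) :
    ENNReal.ofReal (survival F x - survival F y) = ∫⁻ t in Ioc x y, ENNReal.ofReal (f t) := by
  have hsub : Ioc x y ⊆ {x | cdf (F : Measure ℝ) x < 1} := by
    intro t ht
    have := survival_antitone F ht.2
    simp only [survival, mem_ofPred_eq] at *
    linarith
  have h1 : (F : Measure ℝ) (Ioc x y) = ENNReal.ofReal (survival F x - survival F y) := by
    conv_lhs => rw [← measure_cdf (F : Measure ℝ), StieltjesFunction.measure_Ioc]
    congr 1
    simp only [survival]; ring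
  rw [← h1, ← withDensity_apply _ measurableSet_Ioc, ← Measure.restrict_eq_self _ hsub, hF,
    Measure.restrict_eq_self _ hsub]

/-- The logarithm of the survival function of an MHR distribution on `[0, ∞)` is concave; here along
rays through the origin. -/
lemma IsMHR.rpow_survival_le {F : ProbabilityMeasure ℝ} (hF : IsMHR F) (h0 : survival F 0 = 1)
    {c y : ℝ} (hc0 : 0 ≤ c) (hc1 : c ≤ 1) (hy : 0 ≤ y) :
    survival F y ^ c ≤ survival F (c * y) := by
  rcases hc0.eq_or_lt with rfl | hc0
  · simp [h0]
  rcases (survival_nonneg F y).eq_or_lt with hy0 | hSy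
  · rw [← hy0, Real.zero_rpow hc0.ne']; exact survival_nonneg F _
  obtain ⟨f, -, hf0, hFf, hmono⟩ := hF
  set a := c * y with ha
  have hay : a ≤ y := by nlinarith
  have ha0 : 0 ≤ a := by positivity
  have hSpos : ∀ t, t ≤ y → 0 < survival F t := fun t ht => hSy.trans_le (survival_antitone F ht)
  have hmem : ∀ t, t ≤ y → t ∈ {x | cdf (F : Measure ℝ) x < 1} := fun t ht => by
    have := hSpos t ht
    simp only [survival, mem_ofPred_eq] at *; linarith
  -- Compare with the exponential law whose constant rate is the hazard rate at `a`: the true rate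
  -- is at most `R` before `a` and at least `R` between `a` and `y`.
  set R := f a / survival F a with hR
  have hR0 : 0 ≤ R := div_nonneg (hf0 a) (survival_nonneg F a)
  have hle : ∀ t, t ≤ a → f t ≤ R * survival F t := fun t ht => by
    have := hmono (hmem t (ht.trans hay)) (hmem a hay) ht
    exact (div_le_iff₀ (hSpos t (ht.trans hay))).1 this
  have hge : ∀ t, a ≤ t → t ≤ y → R * survival F t ≤ f t := fun t ht hty => by
    have := hmono (hmem a hay) (hmem t hty) ht
    exact (le_div_iff₀ (hSpos t hty)).1 this
  have low : Real.exp (-R * a) ≤ survival F a := by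
    have := mul_exp_le_of_step (S := survival F) (a := 0) (b := a) (r := -R) ha0 ?_
    · simpa [h0] using this
    intro u v hu huv hv
    have h1 : ENNReal.ofReal (survival F u - survival F v) ≤
        ENNReal.ofReal (R * survival F u * (v - u)) := by
      rw [ofReal_survival_sub F hFf (hSpos v (hv.trans hay)),
        ENNReal.ofReal_mul (mul_nonneg hR0 (survival_nonneg F u)), ← Real.volume_Ioc,
        ← setLIntegral_const]
      refine setLIntegral_mono measurable_const fun t ht => ENNReal.ofReal_le_ofReal ?_
      exact (hle t (ht.2.trans hv)).trans
        (mul_le_mul_of_nonneg_left (survival_antitone F ht.1.le) hR0)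
    rw [ENNReal.ofReal_le_ofReal_iff (mul_nonneg (mul_nonneg hR0 (survival_nonneg F u))
      (by linarith))] at h1
    linarith
  have up : survival F y * Real.exp (R * (y - a)) ≤ survival F a := by
    -- Time is reversed so that the decay of `survival F` from `a` to `y` becomes growth.
    have := mul_exp_le_of_step (S := fun x => survival F (-x)) (a := -y) (b := -a) (r := R)
      (by linarith) ?_
    · simpa [neg_add_eq_sub] using this
    intro u v hu huv hv
    have h1 : ENNReal.ofReal (R * survival F (-u) * (v - u)) ≤
        ENNReal.ofReal (survival F (-v) - survival F (-u)) := by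
      rw [ofReal_survival_sub F hFf (hSpos (-u) (by linarith)),
        ENNReal.ofReal_mul (mul_nonneg hR0 (survival_nonneg F _)),
        show v - u = -u - -v by ring, ← Real.volume_Ioc, ← setLIntegral_const]
      refine setLIntegral_mono' measurableSet_Ioc fun t ht => ENNReal.ofReal_le_ofReal ?_
      exact (mul_le_mul_of_nonneg_left (survival_antitone F ht.2) hR0).trans
        (hge t (by linarith [ht.1]) (by linarith [ht.2]))
    rw [ENNReal.ofReal_le_ofReal_iff (by
      linarith [survival_antitone F (show -v ≤ -u by linarith)])] at h1
    linarith
  have hSa : 0 < survival F a := hSpos a hay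
  calc survival F y ^ c ≤ (survival F a * Real.exp (-(R * (y - a)))) ^ c := by
        refine Real.rpow_le_rpow hSy.le ?_ hc0.le
        rw [Real.exp_neg, ← div_eq_mul_inv, le_div_iff₀ (Real.exp_pos _)]
        exact up
    -- The exponents agree because `c * (y - a) = (1 - c) * a` for `a = c * y`.
    _ = survival F a ^ c * Real.exp (-R * a) ^ (1 - c) := by
        rw [Real.mul_rpow hSa.le (Real.exp_pos _).le, ← Real.exp_mul, ← Real.exp_mul]
        congr 2
        rw [ha]; ring
    _ ≤ survival F a ^ c * survival F a ^ (1 - c) := by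
        gcongr
    _ = survival F a := by
        rw [← Real.rpow_add hSa]; simp

lemma survival_of_lt_one {F : ProbabilityMeasure ℝ} {h x : ℝ} (hF : (F : Measure ℝ) (Icc 1 h) = 1)
    (hx : x < 1) : survival F x = 1 := by
  refine le_antisymm (survival_le_one F x) ?_
  rw [survival_eq_real_Ioi]
  calc (1 : ℝ) = (F : Measure ℝ).real (Icc 1 h) := by simp [measureReal_def, hF]
    _ ≤ _ := measureReal_mono fun t ht => hx.trans_le ht.1

lemma survival_of_ge {F : ProbabilityMeasure ℝ} {h x : ℝ} (hF : (F : Measure ℝ) (Icc 1 h) = 1)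
    (hx : h ≤ x) : survival F x = 0 := by
  rw [survival, cdf_eq_real, sub_eq_zero]
  refine le_antisymm ?_ measureReal_le_one
  calc (1 : ℝ) = (F : Measure ℝ).real (Icc 1 h) := by simp [measureReal_def, hF]
    _ ≤ _ := measureReal_mono fun t ht => ht.2.trans hx

/-- An atom can make `survival F` jump over `q`, so the two bounds hold on the two sides of `X`; the
one at `X` itself comes from right-continuity. -/
lemma exists_survival_quantile {F : ProbabilityMeasure ℝ} {h q : ℝ}
    (hF : (F : Measure ℝ) (Icc 1 h) = 1) (hq0 : 0 < q) (hq1 : q ≤ 1) :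
    ∃ X, 1 ≤ X ∧ X ≤ h ∧ (∀ y < X, q ≤ survival F y) ∧ survival F X ≤ q := by
  have hbd : ∀ y, q ≤ survival F y → y ≤ h := fun y hy => by
    by_contra! hlt
    rw [survival_of_ge hF hlt.le] at hy
    linarith
  have hB : BddAbove {y | q ≤ survival F y} := ⟨h, fun y hy => hbd y hy⟩
  have hlow : ∀ y < 1, q ≤ survival F y := fun y hy => by rwa [survival_of_lt_one hF hy]
  have hne : {y | q ≤ survival F y}.Nonempty := ⟨0, hlow 0 one_pos⟩
  refine ⟨sSup {y | q ≤ survival F y}, ?_, csSup_le hne fun y hy => hbd y hy, ?_, ?_⟩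
  · exact le_of_forall_lt fun y hy => by
      obtain ⟨z, hyz, hz⟩ := exists_between hy
      exact hyz.trans_le (le_csSup hB (hlow z hz))
  · intro y hy
    obtain ⟨z, hz, hyz⟩ := exists_lt_of_lt_csSup hne hy
    exact le_trans hz (survival_antitone F hyz.le)
  · set X := sSup {y | q ≤ survival F y}
    have hc : ContinuousWithinAt (survival F) (Ioi X) X :=
      (continuousWithinAt_const.sub ((cdf (F : Measure ℝ)).right_continuous X)).mono
        Ioi_subset_Ici_self
    refine le_of_tendsto hc ?_
    filter_upwards [self_mem_nhdsWithin] with y hy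
    by_contra! hlt
    exact absurd (le_csSup hB (show y ∈ {y | q ≤ survival F y} from hlt.le)) (not_le.2 hy)

lemma IsMHR.lintegral_excess_le {F : ProbabilityMeasure ℝ} (hF : IsMHR F) (h0 : survival F 0 = 1)
    {X θ : ℝ} (hX : 0 < X) (hθ : 0 < θ) (hSX : survival F X ≤ Real.exp (-θ)) :
    ∫⁻ v, ENNReal.ofReal (max (v - X) 0) ∂(F : Measure ℝ) ≤
      ENNReal.ofReal (X * Real.exp (-θ) / θ) := by
  -- Ray concavity with `c = X / t`, raised to the power `t / X`; integrating this tail gives the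
  -- bound.
  have htail : ∀ t, X < t → survival F t ≤ Real.exp (-θ * (t / X)) := fun t ht => by
    have ht0 : 0 < t := hX.trans ht
    have h1 : survival F t ^ (X / t) ≤ Real.exp (-θ) := by
      have := hF.rpow_survival_le h0 (c := X / t) (y := t) (by positivity)
        ((div_le_one ht0).2 ht.le) ht0.le
      rw [div_mul_cancel₀ _ ht0.ne'] at this
      exact this.trans hSX
    have h2 := Real.rpow_le_rpow (Real.rpow_nonneg (survival_nonneg F t) _) h1
      (show 0 ≤ t / X by positivity)
    rw [← Real.rpow_mul (survival_nonneg F t), ← Real.exp_mul] at h2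
    rwa [show X / t * (t / X) = 1 by field_simp, Real.rpow_one] at h2
  rw [lintegral_eq_lintegral_meas_lt (f := fun v => max (v - X) 0) _
    (Filter.Eventually.of_forall fun v => le_max_right _ _)
    (by fun_prop)]
  have hneg : -(θ / X) < 0 := by have := div_pos hθ hX; linarith
  calc ∫⁻ t in Ioi 0, (F : Measure ℝ) {v | t < max (v - X) 0}
      ≤ ∫⁻ t in Ioi 0, ENNReal.ofReal (Real.exp (-θ) * Real.exp (-(θ / X) * t)) := by
        refine setLIntegral_mono' measurableSet_Ioi fun t ht => ?_
        have ht : 0 < t := ht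
        have hset : {v : ℝ | t < max (v - X) 0} = Ioi (X + t) := by
          ext v
          simp only [mem_ofPred_eq, lt_max_iff, mem_Ioi]
          exact ⟨fun h => h.elim (fun h => by linarith) (fun h => by linarith),
            fun h => Or.inl (by linarith)⟩
        rw [hset, ← ofReal_measureReal, ← survival_eq_real_Ioi]
        refine ENNReal.ofReal_le_ofReal ((htail _ (by linarith)).trans_eq ?_)
        rw [← Real.exp_add]
        congr 1
        field_simp
        ring
    _ = ENNReal.ofReal (∫ t in Ioi 0, Real.exp (-θ) * Real.exp (-(θ / X) * t)) := by
        rw [ofReal_integral_eq_lintegral_ofReal]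
        · exact (integrableOn_exp_mul_Ioi hneg 0).const_mul _
        · exact Filter.Eventually.of_forall fun t => by positivity
    _ = _ := by
        rw [integral_const_mul, integral_exp_mul_Ioi hneg]
        congr 1
        simp only [mul_zero, Real.exp_zero]
        field_simp

end PostedPrice

namespace PostedPrice

/-! ### Mean and generating function of Poisson counts. -/

section Poisson

variable {Ω : Type*} [MeasurableSpace Ω] {P : Measure Ω}

lemma lintegral_comp_of_hasLaw_poisson {N : Ω → ℕ∞} {r : NNReal}
    (hN : HasLaw N ((poissonMeasure r).map (fun n : ℕ => (n : ℕ∞))) P) (g : ℕ∞ → ENNReal) :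
    ∫⁻ ω, g (N ω) ∂P =
      ∑' n : ℕ, ENNReal.ofReal (Real.exp (-r) * r ^ n / n.factorial) * g n := by
  have h1 : ∫⁻ ω, g (N ω) ∂P = ∫⁻ k, g k ∂(P.map N) :=
    (lintegral_map' (by fun_prop) hN.aemeasurable).symm
  rw [h1, hN.map_eq, lintegral_map (by fun_prop) (by fun_prop), poissonMeasure,
    lintegral_sum_measure]
  simp

lemma lintegral_of_hasLaw_poisson {N : Ω → ℕ∞} {r : NNReal}
    (hN : HasLaw N ((poissonMeasure r).map (fun n : ℕ => (n : ℕ∞))) P) :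
    ∫⁻ ω, (N ω : ENNReal) ∂P = r := by
  rw [lintegral_comp_of_hasLaw_poisson hN (fun k => (k : ENNReal)), tsum_eq_zero_add' (by simp)]
  have hterm : ∀ n : ℕ, ENNReal.ofReal (Real.exp (-r) * r ^ (n + 1) / (n + 1).factorial) *
      (((n + 1 : ℕ) : ℕ∞) : ENNReal) =
      r * ENNReal.ofReal (Real.exp (-r) * r ^ n / n.factorial) := fun n => by
    rw [← ENNReal.ofReal_coe_nnreal (p := r), ← ENNReal.ofReal_mul (by positivity),
      show (((n + 1 : ℕ) : ℕ∞) : ENNReal) = ENNReal.ofReal ((n + 1 : ℕ) : ℝ) by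
        rw [ENNReal.ofReal_natCast]; simp,
      ← ENNReal.ofReal_mul (by positivity), Nat.factorial_succ]
    congr 1
    push_cast
    field_simp
    ring
  simp_rw [hterm]
  rw [ENNReal.tsum_mul_left, ← ENNReal.ofReal_tsum_of_nonneg (fun n => by positivity)
    (hasSum_one_poissonMeasure r).summable, (hasSum_one_poissonMeasure r).tsum_eq]
  simp

/-- The generating function at `z`. The value `g ⊤` is free because `⊤` has probability zero. -/
lemma lintegral_pow_of_hasLaw_poisson {N : Ω → ℕ∞} {r : NNReal}
    (hN : HasLaw N ((poissonMeasure r).map (fun n : ℕ => (n : ℕ∞))) P) {z : ℝ} (hz : 0 ≤ z)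
    {g : ℕ∞ → ENNReal} (hg : ∀ n : ℕ, g n = ENNReal.ofReal z ^ n) :
    ∫⁻ ω, g (N ω) ∂P = ENNReal.ofReal (Real.exp (-r * (1 - z))) := by
  rw [lintegral_comp_of_hasLaw_poisson hN g]
  have hsum : HasSum (fun n : ℕ => Real.exp (-r) * ((r * z) ^ n / n.factorial))
      (Real.exp (-r) * Real.exp (r * z)) := by
    have := NormedSpace.expSeries_div_hasSum_exp (r * z : ℝ)
    rw [← Real.exp_eq_exp_ℝ] at this
    exact this.mul_left _
  rw [show Real.exp (-r * (1 - z)) = Real.exp (-r) * Real.exp (r * z) by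
    rw [← Real.exp_add]; congr 1; ring, ← hsum.tsum_eq,
    ENNReal.ofReal_tsum_of_nonneg (fun n => by positivity) hsum.summable]
  refine tsum_congr fun n => ?_
  rw [hg, ← ENNReal.ofReal_pow hz, ← ENNReal.ofReal_mul (by positivity)]
  congr 1
  rw [mul_pow]; ring

end Poisson

/-! ### The discount function on the half-line. -/

section Discount

variable {T : ℝ} {ξ : ℝ → ℝ}

lemma IsDiscount.nonneg (hξ : IsDiscount T ξ) {t : ℝ} (ht : 0 ≤ t) : 0 ≤ ξ t := by
  rcases le_total T t with h | h
  · exact (hξ.map_of_ge t h).ge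
  · rw [← hξ.map_of_ge T le_rfl]
    exact hξ.antitoneOn ⟨ht, h⟩ ⟨ht.trans h, le_rfl⟩ h

lemma IsDiscount.antitoneOn_Ici (hξ : IsDiscount T ξ) : AntitoneOn ξ (Ici 0) := by
  intro s hs t ht hst
  rcases le_total T t with h | h
  · rw [hξ.map_of_ge t h]; exact hξ.nonneg hs
  · exact hξ.antitoneOn ⟨hs, hst.trans h⟩ ⟨ht, h⟩ hst

lemma IsDiscount.le_one (hξ : IsDiscount T ξ) {t : ℝ} (ht : 0 ≤ t) : ξ t ≤ 1 := by
  rw [← hξ.map_zero]; exact hξ.antitoneOn_Ici self_mem_Ici ht ht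

lemma IsDiscount.measurable_comp_max (hξ : IsDiscount T ξ) : Measurable fun t => ξ (max t 0) :=
  Antitone.measurable fun _ _ hst =>
    hξ.antitoneOn_Ici (mem_Ici.2 (le_max_right _ _)) (mem_Ici.2 (le_max_right _ _)) (max_le_max_right 0 hst)

end Discount

/-! ### Pathwise bounds on the revenue. -/

section Revenue

variable {T : ℝ} {ξ p : ℝ → ℝ} {w v : ℕ → ℝ}

lemma revenue_eq_zero_or (T : ℝ) (ξ p : ℝ → ℝ) (w v : ℕ → ℝ) :
    ((∀ i, ¬(w i ≤ T ∧ p (w i) ≤ v i * ξ (w i))) ∧ revenue T ξ p w v = 0) ∨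
    ∃ i, (w i ≤ T ∧ p (w i) ≤ v i * ξ (w i)) ∧
      (∀ j, w j ≤ T ∧ p (w j) ≤ v j * ξ (w j) → i ≤ j) ∧ revenue T ξ p w v = p (w i) := by
  classical
  by_cases H : ∃ i, w i ≤ T ∧ p (w i) ≤ v i * ξ (w i)
  · refine Or.inr ⟨Nat.find H, Nat.find_spec H, fun j hj => Nat.find_min' H hj, ?_⟩
    rw [revenue, dif_pos H]
  · exact Or.inl ⟨not_exists.1 H, by rw [revenue, dif_neg H]⟩

lemma revenue_congr {ξ' : ℝ → ℝ} (h : ∀ i, ξ (w i) = ξ' (w i)) :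
    revenue T ξ p w v = revenue T ξ' p w v := by
  classical
  exact congrArg (fun a : ℕ → ℝ => if H : ∃ i, w i ≤ T ∧ p (w i) ≤ v i * a i then
    p (w (Nat.find H)) else 0) (funext h)

lemma revenue_nonneg (hw : ∀ i, 0 < w i) (hp : ∀ t, 0 < t → t ≤ T → 0 ≤ p t) :
    0 ≤ revenue T ξ p w v := by
  obtain ⟨-, h⟩ | ⟨i, hi, -, h⟩ := revenue_eq_zero_or T ξ p w v
  · exact h.ge
  · rw [h]; exact hp _ (hw i) hi.1

lemma revenue_le_of_bounded (hξ : IsDiscount T ξ) (hw : ∀ i, 0 < w i) {h : ℝ}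
    (hv : ∀ i, v i ∈ Icc 1 h) : revenue T ξ p w v ≤ h := by
  obtain ⟨-, h0⟩ | ⟨i, hi, -, h0⟩ := revenue_eq_zero_or T ξ p w v
  · rw [h0]; linarith [(hv 0).1, (hv 0).2]
  · rw [h0]
    have h1 := hξ.le_one (hw i).le
    have h2 := hξ.nonneg (hw i).le
    nlinarith [(hv i).1, (hv i).2, hi.2]

/-- The buyer pays at most `v i ≤ X + (v i - X)⁺`, and the sum over all arrivals contains the
buyer's term. -/
lemma ofReal_revenue_le (hξ : IsDiscount T ξ) (hw : ∀ i, 0 < w i) (hv : ∀ i, 0 ≤ v i) (X : ℝ) :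
    ENNReal.ofReal (revenue T ξ p w v) ≤ ENNReal.ofReal X +
      ∑' i, (Ioc 0 T).indicator 1 (w i) * ENNReal.ofReal (max (v i - X) 0) := by
  obtain ⟨-, h⟩ | ⟨i, hi, -, h⟩ := revenue_eq_zero_or T ξ p w v
  · simp [h]
  · rw [h]
    have hle : p (w i) ≤ X + max (v i - X) 0 := by
      have h1 := hξ.le_one (hw i).le
      have h2 := le_max_left (v i - X) 0
      nlinarith [hv i, hi.2]
    refine ((ENNReal.ofReal_le_ofReal hle).trans ENNReal.ofReal_add_le).trans ?_
    gcongr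
    refine le_trans ?_ (ENNReal.le_tsum i)
    rw [indicator_of_mem (show w i ∈ Ioc 0 T from ⟨hw i, hi.1⟩)]
    simp

/-- The agent with valuation at least `l` would accept, so the item goes to this agent or an earlier
one, at a time when the price is still at least `π`. -/
lemma le_revenue {s t l π : ℝ} (ht : t ≤ T) (hw : ∀ i, 0 < w i) (hmono : Monotone w)
    (hξ : ∀ u, s < u → u ≤ t → 0 ≤ ξ u)
    (hπ : ∀ u, 0 < u → u ≤ t → π ≤ p u) (hl : ∀ u, s < u → u ≤ t → p u ≤ l * ξ u)
    (hex : ∃ i, (s < w i ∧ w i ≤ t) ∧ l ≤ v i) : π ≤ revenue T ξ p w v := by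
  obtain ⟨i, ⟨hsi, hit⟩, hli⟩ := hex
  have hi : w i ≤ T ∧ p (w i) ≤ v i * ξ (w i) :=
    ⟨hit.trans ht, (hl _ hsi hit).trans (mul_le_mul_of_nonneg_right hli (hξ _ hsi hit))⟩
  obtain ⟨h, -⟩ | ⟨j, -, hmin, h⟩ := revenue_eq_zero_or T ξ p w v
  · exact absurd hi (h i)
  · rw [h]; exact hπ _ (hw j) ((hmono (hmin i hi)).trans hit)

lemma measurable_revenue {α : Type*} [MeasurableSpace α] {w v : ℕ → α → ℝ}
    (hw : ∀ i, Measurable (w i)) (hv : ∀ i, Measurable (v i)) (hξ : Measurable ξ)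
    (hp : Measurable p) :
    Measurable fun x => revenue T ξ p (fun i => w i x) (fun i => v i x) := by
  classical
  set c : ℕ → α → Prop := fun i x => w i x ≤ T ∧ p (w i x) ≤ v i x * ξ (w i x) with hc
  have hcm : ∀ i, MeasurableSet {x | c i x} := fun i =>
    (measurableSet_le (hw i) measurable_const).inter
      (measurableSet_le (hp.comp (hw i)) ((hv i).mul (hξ.comp (hw i))))
  have hex : MeasurableSet {x | ∃ i, c i x} := by
    rw [ofPred_exists]; exact MeasurableSet.iUnion hcm
  -- Padding the condition makes the search for the first buyer total; the padded value is discarded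
  -- when nobody buys.
  have hfind : ∀ x, ∃ i, c i x ∨ ¬∃ k, c k x := fun x => by
    by_cases h : ∃ k, c k x
    · exact h.imp fun k hk => Or.inl hk
    · exact ⟨0, Or.inr h⟩
  have hm : Measurable fun x => p (w (Nat.find (hfind x)) x) :=
    Measurable.find (f := fun i x => p (w i x)) (p := fun i x => c i x ∨ ¬∃ k, c k x)
      (fun i => hp.comp (hw i))
      (fun i => (hcm i).union hex.compl) hfind
  have heq : (fun x => revenue T ξ p (fun i => w i x) (fun i => v i x)) =
      fun x => if ∃ i, c i x then p (w (Nat.find (hfind x)) x) else 0 := by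
    funext x
    by_cases h : ∃ i, c i x
    · rw [revenue, dif_pos h, if_pos h]
      congr 2
      exact Nat.find_congr' fun {n} => (or_iff_left (not_not.2 h)).symm
    · rw [revenue, dif_neg h, if_neg h]
  rw [heq]
  exact Measurable.ite hex hm measurable_const

end Revenue

end PostedPrice

namespace PostedPrice

lemma tsum_indicator_eq_arrivalCount {Ω : Type*} (W : ℕ → Ω → ℝ) (s t : ℝ) (ω : Ω) :
    ∑' i, (Ioc s t).indicator (1 : ℝ → ENNReal) (W i ω) = (arrivalCount W s t ω : ENNReal) := by
  rw [arrivalCount, ← ENNReal.tsum_set_one,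
    tsum_subtype {i | s < W i ω ∧ W i ω ≤ t} fun _ => (1 : ENNReal)]
  rfl

/-! ### Expected revenue under Poisson arrivals and i.i.d. valuations. -/

section Market

variable {Ω : Type*} [MeasurableSpace Ω] {P : Measure Ω}
  {lam T h : ℝ} {W : ℕ → Ω → ℝ} {F : ProbabilityMeasure ℝ} {ξ p : ℝ → ℝ}

/-- The joint law of the arrivals and of i.i.d. initial valuations with law `F`. -/
noncomputable abbrev marketLaw (P : Measure Ω) (F : ProbabilityMeasure ℝ) :
    Measure (Ω × (ℕ → ℝ)) :=
  P.prod (Measure.infinitePi fun _ : ℕ => (F : Measure ℝ))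

lemma ae_arrivals (hW : IsPoissonArrivals P lam W) (F : ProbabilityMeasure ℝ) :
    ∀ᵐ x ∂marketLaw P F, (∀ i, 0 < W i x.1) ∧ Monotone fun i => W i x.1 :=
  (Measure.quasiMeasurePreserving_fst (μ := P)).ae (hW.pos.and hW.monotone)

/-- An agent with valuation at least `l` arrives in `(s, t]`. -/
def acceptanceEvent (W : ℕ → Ω → ℝ) (s t l : ℝ) : Set (Ω × (ℕ → ℝ)) :=
  {x | ∃ i, (s < W i x.1 ∧ W i x.1 ≤ t) ∧ l ≤ x.2 i}

lemma measurableSet_acceptanceEvent (hW : IsPoissonArrivals P lam W) (s t l : ℝ) :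
    MeasurableSet (acceptanceEvent W s t l) := by
  rw [acceptanceEvent, ofPred_exists]
  refine MeasurableSet.iUnion fun i => ?_
  have h1 : Measurable fun x : Ω × (ℕ → ℝ) => W i x.1 := (hW.measurable i).comp measurable_fst
  have h2 : Measurable fun x : Ω × (ℕ → ℝ) => x.2 i :=
    (measurable_pi_apply i).comp measurable_snd
  exact ((measurableSet_lt measurable_const h1).inter (measurableSet_le h1 measurable_const)).inter
    (measurableSet_le measurable_const h2)

/-- Wald's identity: valuations are independent of arrivals, so each term factors and the indicators
sum to the mean number of arrivals. -/
lemma lintegral_tsum_arrivals (hW : IsPoissonArrivals P lam W) (hT : 0 ≤ T) {g : ℝ → ENNReal}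
    (hg : Measurable g) :
    ∫⁻ x, ∑' i, (Ioc 0 T).indicator 1 (W i x.1) * g (x.2 i) ∂marketLaw P F =
      ENNReal.ofReal (lam * T) * ∫⁻ v, g v ∂(F : Measure ℝ) := by
  have hind : ∀ i, Measurable fun ω => (Ioc 0 T).indicator (1 : ℝ → ENNReal) (W i ω) := fun i =>
    (measurable_one.indicator measurableSet_Ioc).comp (hW.measurable i)
  have hgi : ∀ i : ℕ, Measurable fun v : ℕ → ℝ => g (v i) := fun i =>
    hg.comp (measurable_pi_apply i)
  have hmul : ∀ i, Measurable fun x : Ω × (ℕ → ℝ) =>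
      (Ioc 0 T).indicator (1 : ℝ → ENNReal) (W i x.1) * g (x.2 i) := fun i =>
    ((hind i).comp measurable_fst).mul ((hgi i).comp measurable_snd)
  rw [lintegral_tsum fun i => (hmul i).aemeasurable]
  have h1 : ∀ i, ∫⁻ x, (Ioc 0 T).indicator 1 (W i x.1) * g (x.2 i) ∂marketLaw P F =
      (∫⁻ ω, (Ioc 0 T).indicator 1 (W i ω) ∂P) * ∫⁻ v, g v ∂(F : Measure ℝ) := fun i => by
    rw [lintegral_prod_mul (hind i).aemeasurable (hgi i).aemeasurable]
    congr 1
    exact (measurePreserving_eval_infinitePi (fun _ : ℕ => (F : Measure ℝ)) i).lintegral_comp hg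
  simp_rw [h1]
  rw [ENNReal.tsum_mul_right, ← lintegral_tsum fun i => (hind i).aemeasurable]
  simp_rw [tsum_indicator_eq_arrivalCount]
  rw [lintegral_of_hasLaw_poisson (hW.hasLaw 0 T le_rfl hT), sub_zero]
  rfl

variable [IsProbabilityMeasure P]

lemma ae_valuations (P : Measure Ω) [IsProbabilityMeasure P]
    (hF : (F : Measure ℝ) (Icc 1 h) = 1) :
    ∀ᵐ x ∂marketLaw P F, ∀ i, x.2 i ∈ Icc 1 h := by
  refine (Measure.quasiMeasurePreserving_snd (ν := Measure.infinitePi fun _ => (F : Measure ℝ))).ae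
    (p := fun v : ℕ → ℝ => ∀ i, v i ∈ Icc 1 h) (ae_all_iff.2 fun i => ?_)
  refine (measurePreserving_eval_infinitePi (fun _ : ℕ => (F : Measure ℝ)) i).quasiMeasurePreserving.ae
    (p := fun v : ℝ => v ∈ Icc 1 h) ?_
  exact (mem_ae_iff_prob_eq_one measurableSet_Icc).2 hF

/-- The expected revenue is at most `X` plus the expected total excess of the arriving valuations
over `X`. -/
lemma expectedRevenue_le (hW : IsPoissonArrivals P lam W) (hlam : 0 ≤ lam) (hT : 0 ≤ T)
    (hξ : IsDiscount T ξ)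
    (hF : (F : Measure ℝ) (Icc 1 h) = 1) (hp : ∀ t ∈ Icc 0 T, 0 ≤ p t) {X e : ℝ} (hX : 0 ≤ X)
    (he : 0 ≤ e)
    (hXe : ∫⁻ v, ENNReal.ofReal (max (v - X) 0) ∂(F : Measure ℝ) ≤ ENNReal.ofReal e) :
    expectedRevenue P W T ξ F p ≤ X + lam * T * e := by
  have hR : 0 ≤ X + lam * T * e := by positivity
  rw [expectedRevenue]
  -- Measurability of `p` is not assumed here; a non-integrable revenue has integral `0` by
  -- convention.
  by_cases hint : Integrable (fun x : Ω × (ℕ → ℝ) => revenue T ξ p (fun i => W i x.1) x.2)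
    (marketLaw P F)
  swap
  · rwa [integral_undef hint]
  rw [integral_eq_lintegral_of_nonneg_ae _ hint.aestronglyMeasurable]
  · refine ENNReal.toReal_le_of_le_ofReal hR ?_
    calc _ ≤ ∫⁻ x, (ENNReal.ofReal X + ∑' i, (Ioc 0 T).indicator 1 (W i x.1) *
            ENNReal.ofReal (max (x.2 i - X) 0)) ∂marketLaw P F := by
          refine lintegral_mono_ae ?_
          filter_upwards [ae_arrivals hW F, ae_valuations P hF] with x hx hv
          exact ofReal_revenue_le hξ hx.1 (fun i => zero_le_one.trans (hv i).1) X
      _ ≤ ENNReal.ofReal X + ENNReal.ofReal (lam * T) * ENNReal.ofReal e := by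
          rw [lintegral_add_left measurable_const, lintegral_const, measure_univ, mul_one,
            lintegral_tsum_arrivals hW hT (g := fun v => ENNReal.ofReal (max (v - X) 0))
              (by fun_prop)]
          gcongr
      _ = _ := by
          rw [← ENNReal.ofReal_mul (by positivity), ← ENNReal.ofReal_add hX (by positivity)]
  · filter_upwards [ae_arrivals hW F] with x hx
    exact revenue_nonneg hx.1 fun t h0 ht => hp t ⟨h0.le, ht⟩

lemma integrable_revenue (hW : IsPoissonArrivals P lam W) (hξ : IsDiscount T ξ)
    (hF : (F : Measure ℝ) (Icc 1 h) = 1) (hpm : Measurable p)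
    (hp : ∀ t, 0 < t → t ≤ T → 0 ≤ p t) :
    Integrable (fun x : Ω × (ℕ → ℝ) => revenue T ξ p (fun i => W i x.1) x.2)
      (marketLaw P F) := by
  -- `ξ` is arbitrary at negative times, so it is replaced by a monotone, hence measurable, function
  -- that agrees with it at all arrivals almost surely.
  have hm : Measurable fun x : Ω × (ℕ → ℝ) =>
      revenue T (fun t => ξ (max t 0)) p (fun i => W i x.1) (fun i => x.2 i) :=
    measurable_revenue (w := fun i (x : Ω × (ℕ → ℝ)) => W i x.1) (v := fun i x => x.2 i)
      (fun i => (hW.measurable i).comp measurable_fst)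
      (fun i => (measurable_pi_apply i).comp measurable_snd) hξ.measurable_comp_max hpm
  refine Integrable.of_bound (C := h) ⟨_, hm.stronglyMeasurable, ?_⟩ ?_
  · filter_upwards [ae_arrivals hW F] with x hx
    exact revenue_congr fun i => by rw [max_eq_left (hx.1 i).le]
  · filter_upwards [ae_arrivals hW F, ae_valuations P hF] with x hx hv
    rw [Real.norm_of_nonneg (revenue_nonneg hx.1 hp)]
    exact revenue_le_of_bounded hξ hx.1 hv

lemma infinitePi_forall_lt_le (F : ProbabilityMeasure ℝ) (S : Set ℕ) (l : ℝ) {g : ℕ∞ → ENNReal}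
    (hg : ∀ n : ℕ, g n = (F : Measure ℝ) (Iio l) ^ n) (hg' : g ⊤ = 1) :
    Measure.infinitePi (fun _ : ℕ => (F : Measure ℝ)) {v | ∀ i ∈ S, v i < l} ≤ g S.encard := by
  by_cases hS : S.Finite
  · obtain ⟨s, rfl⟩ := hS.exists_finset_coe
    rw [encard_coe_eq_coe_finsetCard, hg]
    have := Measure.infinitePi_pi (fun _ : ℕ => (F : Measure ℝ)) (s := s) (t := fun _ => Iio l)
      fun _ _ => measurableSet_Iio
    rw [Finset.prod_const] at this
    exact this.le
  · rw [Infinite.encard_eq hS, hg']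
    exact prob_le_one

lemma le_measureReal_acceptanceEvent (hW : IsPoissonArrivals P lam W) (hlam : 0 ≤ lam) {s t : ℝ}
    (hs : 0 ≤ s) (hst : s ≤ t) (l : ℝ) :
    1 - Real.exp (-(lam * (t - s)) * (F : Measure ℝ).real (Ici l)) ≤
      (marketLaw P F).real (acceptanceEvent W s t l) := by
  have hm := measurableSet_acceptanceEvent hW s t l
  have hz : (F : Measure ℝ).real (Ici l) = 1 - (F : Measure ℝ).real (Iio l) := by
    rw [← compl_Iio, probReal_compl_eq_one_sub measurableSet_Iio]
  -- The value `1` at `⊤` makes the bound trivial for infinitely many arrivals, a null event.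
  set g : ℕ∞ → ENNReal := fun k => if k = ⊤ then 1 else (F : Measure ℝ) (Iio l) ^ k.toNat with hg
  have hgn : ∀ n : ℕ, g n = (F : Measure ℝ) (Iio l) ^ n := fun n => by simp [hg]
  have hcompl : marketLaw P F (acceptanceEvent W s t l)ᶜ ≤
      ENNReal.ofReal (Real.exp (-(lam * (t - s)) * (F : Measure ℝ).real (Ici l))) := by
    rw [marketLaw, Measure.prod_apply hm.compl]
    calc _ ≤ ∫⁻ ω, g (arrivalCount W s t ω) ∂P := by
          refine lintegral_mono fun ω => ?_
          refine le_trans (measure_mono ?_)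
            (infinitePi_forall_lt_le F {i | s < W i ω ∧ W i ω ≤ t} l hgn (by simp [hg]))
          intro v hv i hi
          by_contra! hl
          exact hv ⟨i, hi, hl⟩
      _ = _ := by
          rw [lintegral_pow_of_hasLaw_poisson (hW.hasLaw s t hs hst)
            (z := (F : Measure ℝ).real (Iio l)) measureReal_nonneg
            (fun n => by rw [hgn, ofReal_measureReal]), hz,
            Real.coe_toNNReal _ (mul_nonneg hlam (by linarith))]
  have h1 := ENNReal.toReal_le_of_le_ofReal (Real.exp_pos _).le hcompl
  have h2 := probReal_compl_eq_one_sub (μ := marketLaw P F) hm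
  rw [measureReal_def] at h2
  linarith

lemma le_expectedRevenue (hW : IsPoissonArrivals P lam W) (hlam : 0 ≤ lam) (hξ : IsDiscount T ξ)
    (hF : (F : Measure ℝ) (Icc 1 h) = 1) (hpm : Measurable p)
    (hp : ∀ t, 0 < t → t ≤ T → 0 ≤ p t) {s t l π : ℝ} (hs : 0 ≤ s) (hst : s ≤ t) (ht : t ≤ T)
    (hπ0 : 0 ≤ π) (hπ : ∀ u, 0 < u → u ≤ t → π ≤ p u)
    (hl : ∀ u, s < u → u ≤ t → p u ≤ l * ξ u) :
    π * (1 - Real.exp (-(lam * (t - s)) * (F : Measure ℝ).real (Ici l))) ≤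
      expectedRevenue P W T ξ F p := by
  have hm := measurableSet_acceptanceEvent hW s t l
  calc _ ≤ π * (marketLaw P F).real (acceptanceEvent W s t l) :=
        mul_le_mul_of_nonneg_left (le_measureReal_acceptanceEvent hW hlam hs hst l) hπ0
    _ = ∫ x, (acceptanceEvent W s t l).indicator (fun _ => π) x ∂marketLaw P F := by
        rw [integral_indicator_const _ hm, smul_eq_mul, mul_comm]
    _ ≤ _ := by
        rw [expectedRevenue]
        refine integral_mono_ae ((integrable_const π).indicator hm)
          (integrable_revenue hW hξ hF hpm hp) ?_
        filter_upwards [ae_arrivals hW F] with x hx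
        by_cases hxe : x ∈ acceptanceEvent W s t l
        · rw [indicator_of_mem hxe]
          exact le_revenue ht hx.1 hx.2 (fun u hu _ => hξ.nonneg (hs.trans hu.le)) hπ hl hxe
        · rw [indicator_of_notMem hxe]
          exact revenue_nonneg hx.1 hp

end Market

end PostedPrice

namespace PostedPrice

/-! ### The price grid and the revenue it guarantees. -/

section PiecewiseConstant

variable {T τ h δ : ℝ} {ξ : ℝ → ℝ}

lemma pcIntervalPrice_nonneg (hξ : IsDiscount T ξ) (hτ : 0 < τ) (hh : 0 ≤ h) (hδ : 0 ≤ δ) {i : ℕ}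
    (hi : 1 ≤ i) : 0 ≤ pcIntervalPrice T τ h δ ξ i := by
  have hi' : (1 : ℝ) ≤ i := by exact_mod_cast hi
  have h1 := hξ.nonneg (t := i * τ) (by positivity)
  have h2 := hξ.nonneg (t := ((i : ℝ) - 1) * τ) (mul_nonneg (by linarith) hτ.le)
  rw [pcIntervalPrice]
  split_ifs <;> positivity

lemma pcPrice_nonneg (hξ : IsDiscount T ξ) (hτ : 0 < τ) (hh : 0 ≤ h) (hδ : 0 ≤ δ) (t : ℝ) :
    0 ≤ pcPrice T τ h δ ξ t :=
  pcIntervalPrice_nonneg hξ hτ hh hδ (le_max_left _ _)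

lemma measurable_pcPrice (T τ h δ : ℝ) (ξ : ℝ → ℝ) : Measurable (pcPrice T τ h δ ξ) :=
  (Measurable.of_discrete (f := fun n : ℕ => pcIntervalPrice T τ h δ ξ (max 1 n))).comp
    (Nat.measurable_ceil.comp (measurable_id.div_const τ))

/-- The level of undiscounted valuations at which the `i`-th interval price is aimed. -/
noncomputable def pcLevel (h δ : ℝ) (i : ℕ) : ℝ :=
  if i ≤ ⌊Real.logb δ h⌋₊ then h / δ ^ i else 1

lemma pow_floor_logb_le (hδ : 1 < δ) (hh : 1 ≤ h) : δ ^ ⌊Real.logb δ h⌋₊ ≤ h := by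
  have h1 := Nat.floor_le (Real.logb_nonneg hδ hh)
  rw [Real.le_logb_iff_rpow_le hδ (by linarith)] at h1
  exact_mod_cast h1

lemma lt_pow_floor_logb_add_one (hδ : 1 < δ) (hh : 1 ≤ h) :
    h < δ ^ (⌊Real.logb δ h⌋₊ + 1) := by
  have h1 := Nat.lt_floor_add_one (Real.logb δ h)
  rw [Real.logb_lt_iff_lt_rpow hδ (by linarith)] at h1
  exact_mod_cast h1

lemma one_le_pcLevel (hδ : 1 < δ) (hh : 1 ≤ h) (i : ℕ) : 1 ≤ pcLevel h δ i := by
  rw [pcLevel]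
  split_ifs with hi
  · rw [one_le_div (by positivity)]
    exact (pow_le_pow_right₀ hδ.le hi).trans (pow_floor_logb_le hδ hh)
  · exact le_rfl

lemma pcLevel_antitone (hδ : 1 < δ) (hh : 1 ≤ h) : Antitone (pcLevel h δ) := by
  intro i j hij
  by_cases hj : j ≤ ⌊Real.logb δ h⌋₊
  · rw [pcLevel, pcLevel, if_pos hj, if_pos (hij.trans hj)]
    have := pow_le_pow_right₀ hδ.le hij
    gcongr
  · rw [pcLevel, if_neg hj]
    exact one_le_pcLevel hδ hh i

/-- Interval `⌊log_δ h⌋ + 1` ends before `T`, so the special price of a last interval does not occur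
up to this index. -/
lemma pcIntervalPrice_eq (hτ : 0 < τ) (hT : ((⌊Real.logb δ h⌋₊ : ℝ) + 1) * τ < T) {i : ℕ}
    (hi : i ≤ ⌊Real.logb δ h⌋₊ + 1) :
    pcIntervalPrice T τ h δ ξ i = pcLevel h δ i * ξ (i * τ) := by
  rw [pcIntervalPrice, pcLevel]
  by_cases him : i ≤ ⌊Real.logb δ h⌋₊
  · rw [if_pos him, if_pos him]
  · have hlt : i < ⌈T / τ⌉₊ := by
      rw [Nat.lt_ceil, lt_div_iff₀ hτ]
      refine lt_of_le_of_lt ?_ hT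
      gcongr
      exact_mod_cast hi
    rw [if_neg him, if_neg him, if_pos hlt, one_mul]

lemma pcPrice_eq (hτ : 0 < τ) (hT : ((⌊Real.logb δ h⌋₊ : ℝ) + 1) * τ < T) {j : ℕ}
    (hj : j ≤ ⌊Real.logb δ h⌋₊ + 1) {t : ℝ} (ht0 : 0 < t) (ht : t ≤ j * τ) :
    ⌈t / τ⌉₊ ≤ j ∧ pcPrice T τ h δ ξ t = pcLevel h δ ⌈t / τ⌉₊ * ξ (⌈t / τ⌉₊ * τ) := by
  have h1 : ⌈t / τ⌉₊ ≤ j := by rwa [Nat.ceil_le, div_le_iff₀ hτ]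
  have h2 : 1 ≤ ⌈t / τ⌉₊ := Nat.one_le_ceil_iff.2 (by positivity)
  exact ⟨h1, by rw [pcPrice, max_eq_right h2, pcIntervalPrice_eq hτ hT (h1.trans hj)]⟩

/-- Take the first grid level `h / δ ^ j` not above `x`: its predecessor exceeds `x`, so at most a
factor `δ` is lost. Below the grid, level `1` is accepted by everyone. -/
lemma exists_pcLevel {F : ProbabilityMeasure ℝ} (hF : (F : Measure ℝ) (Icc 1 h) = 1)
    (hδ : 1 < δ) (hh : 1 ≤ h) {x : ℝ} (hx : x < h) :
    ∃ j, 1 ≤ j ∧ j ≤ ⌊Real.logb δ h⌋₊ + 1 ∧ x / δ ≤ pcLevel h δ j ∧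
      survival F x ≤ (F : Measure ℝ).real (Ici (pcLevel h δ j)) := by
  have hδ0 : 0 < δ := by linarith
  set m := ⌊Real.logb δ h⌋₊ with hm
  rcases le_or_gt x (h / δ ^ m) with hxm | hxm
  · refine ⟨m + 1, by omega, le_rfl, ?_, ?_⟩
    · have : x / δ ≤ 1 := by
        rw [div_le_one hδ0]
        refine hxm.trans ?_
        rw [div_le_iff₀ (by positivity), ← pow_succ']
        exact (lt_pow_floor_logb_add_one hδ hh).le
      exact this.trans (one_le_pcLevel hδ hh _)
    · rw [pcLevel, if_neg (by omega)]
      refine (survival_le_one F x).trans ?_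
      calc (1 : ℝ) = (F : Measure ℝ).real (Icc 1 h) := by simp [measureReal_def, hF]
        _ ≤ _ := measureReal_mono fun t ht => ht.1
  · classical
    have hex : ∃ j : ℕ, h / δ ^ j ≤ x := ⟨m, hxm.le⟩
    have hjm : Nat.find hex ≤ m := Nat.find_min' hex hxm.le
    have hj1 : 1 ≤ Nat.find hex := by
      rw [Nat.one_le_iff_ne_zero, Ne, Nat.find_eq_zero]
      simpa using hx
    obtain ⟨i, hi⟩ : ∃ i, Nat.find hex = i + 1 := ⟨Nat.find hex - 1, by omega⟩
    have hspec := Nat.find_spec hex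
    have hmin := Nat.find_min hex (m := i) (by omega)
    rw [hi] at hspec hjm
    refine ⟨i + 1, by omega, by omega, ?_, ?_⟩
    · rw [pcLevel, if_pos hjm, div_le_iff₀ hδ0, pow_succ, ← div_div, div_mul_cancel₀ _ hδ0.ne']
      exact (not_le.1 hmin).le
    · rw [pcLevel, if_pos hjm, survival_eq_real_Ioi]
      exact measureReal_mono fun t ht => hspec.trans (le_of_lt ht)

lemma le_expectedRevenue_pcPrice {Ω : Type*} [MeasurableSpace Ω] {P : Measure Ω}
    [IsProbabilityMeasure P] {lam : ℝ} {W : ℕ → Ω → ℝ} {F : ProbabilityMeasure ℝ}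
    (hW : IsPoissonArrivals P lam W) (hlam : 0 ≤ lam) (hξ : IsDiscount T ξ)
    (hF : (F : Measure ℝ) (Icc 1 h) = 1) (hδ : 1 < δ) (hh : 1 ≤ h) (hτ : 0 < τ)
    (hT : ((⌊Real.logb δ h⌋₊ : ℝ) + 1) * τ < T) {x : ℝ} (hx : x < h) :
    ξ (((⌊Real.logb δ h⌋₊ : ℝ) + 1) * τ) * (x / δ) *
        (1 - Real.exp (-(lam * τ) * survival F x)) ≤
      expectedRevenue P W T ξ F (pcPrice T τ h δ ξ) := by
  obtain ⟨j, hj1, hjm, hxj, hSj⟩ := exists_pcLevel hF hδ hh hx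
  have hj1' : (1 : ℝ) ≤ j := by exact_mod_cast hj1
  have hjm' : (j : ℝ) ≤ (⌊Real.logb δ h⌋₊ : ℝ) + 1 := by exact_mod_cast hjm
  have hjT : j * τ ≤ T := (mul_le_mul_of_nonneg_right hjm' hτ.le).trans hT.le
  have hl := one_le_pcLevel hδ hh j
  have hξj : ξ (((⌊Real.logb δ h⌋₊ : ℝ) + 1) * τ) ≤ ξ (j * τ) :=
    hξ.antitoneOn_Ici (mem_Ici.2 (by positivity)) (mem_Ici.2 (by positivity))
      (mul_le_mul_of_nonneg_right hjm' hτ.le)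
  have hξj0 : 0 ≤ ξ (j * τ) := hξ.nonneg (by positivity)
  -- Only arrivals in interval `j` are counted, but an earlier sale does no harm: the posted prices
  -- up to time `j * τ` are all at least `π`.
  have key := le_expectedRevenue (p := pcPrice T τ h δ ξ) (s := ((j : ℝ) - 1) * τ) (t := j * τ)
    (l := pcLevel h δ j) (π := pcLevel h δ j * ξ (j * τ)) hW hlam hξ hF
    (measurable_pcPrice T τ h δ ξ)
    (fun t _ _ => pcPrice_nonneg hξ hτ (by linarith) (by linarith) t)
    (mul_nonneg (by linarith) hτ.le) (by nlinarith) hjT (by positivity)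
    (fun u hu0 hu => by
      obtain ⟨hi, he⟩ := pcPrice_eq (ξ := ξ) hτ hT hjm hu0 hu
      have hi' : (⌈u / τ⌉₊ : ℝ) ≤ j := by exact_mod_cast hi
      rw [he]
      exact mul_le_mul (pcLevel_antitone hδ hh hi)
        (hξ.antitoneOn_Ici (mem_Ici.2 (by positivity)) (mem_Ici.2 (by positivity))
          (mul_le_mul_of_nonneg_right hi' hτ.le)) hξj0
        (by linarith [one_le_pcLevel hδ hh ⌈u / τ⌉₊]))
    (fun u hsu hu => by
      have hu0 : 0 < u := lt_of_le_of_lt (mul_nonneg (by linarith) hτ.le) hsu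
      obtain ⟨hi, he⟩ := pcPrice_eq (ξ := ξ) hτ hT hjm hu0 hu
      have hji : j ≤ ⌈u / τ⌉₊ := by
        have : ((j - 1 : ℕ) : ℝ) < u / τ := by
          rw [lt_div_iff₀ hτ, Nat.cast_sub hj1]; simpa using hsu
        have := Nat.lt_ceil.2 this
        omega
      rw [he, le_antisymm hi hji]
      exact mul_le_mul_of_nonneg_left
        (hξ.antitoneOn_Ici (mem_Ici.2 hu0.le) (mem_Ici.2 (by positivity)) hu) (by linarith))
  refine le_trans ?_ key
  rw [show (j : ℝ) * τ - (j - 1) * τ = τ by ring, mul_comm (ξ _) (x / δ)]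
  have hexp : Real.exp (-(lam * τ) * (F : Measure ℝ).real (Ici (pcLevel h δ j))) ≤
      Real.exp (-(lam * τ) * survival F x) := by
    rw [Real.exp_le_exp]
    have := mul_le_mul_of_nonneg_left hSj (mul_nonneg hlam hτ.le)
    linarith
  have hone : Real.exp (-(lam * τ) * survival F x) ≤ 1 := by
    rw [Real.exp_le_one_iff]
    have := mul_nonneg (mul_nonneg hlam hτ.le) (survival_nonneg F x)
    linarith
  have hδ0 : 0 < δ := by linarith
  refine mul_le_mul (mul_le_mul hxj hξj (hξ.nonneg (by positivity)) (by linarith)) (by linarith)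
    (by linarith) (by positivity)

end PiecewiseConstant

/-! ### The numerical inequality behind the constant `1 / e`. -/

section Numerics

lemma one_add_exp_div_le_of_two_le {l c : ℝ} (hl : Real.log 2 ≤ l) (hc : c ≤ 1 / 2) :
    1 + Real.exp (-1) / (l + 1) ≤ Real.exp 1 * (1 - Real.exp (-Real.exp (-c * 1))) := by
  have hlog := Real.log_two_gt_d9
  have he := Real.exp_one_gt_d9
  have h1 : Real.exp (1 / 2) ≤ 1.6489 := by
    refine (Real.exp_bound' (by norm_num) (by norm_num) (n := 6) (by norm_num)).trans ?_
    norm_num [Finset.sum_range_succ, Nat.factorial]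
  have h2 : (0.6064 : ℝ) ≤ Real.exp (-c * 1) := by
    refine le_trans ?_ (Real.exp_le_exp.2 (show -(1 / 2 : ℝ) ≤ -c * 1 by linarith))
    rw [Real.exp_neg, le_inv_comm₀ (by norm_num) (Real.exp_pos _)]
    exact h1.trans (by norm_num)
  have h3 : Real.exp (-Real.exp (-c * 1)) ≤ 0.546 := by
    refine (Real.exp_le_exp.2 (neg_le_neg h2)).trans ?_
    rw [Real.exp_neg, inv_le_comm₀ (Real.exp_pos _) (by norm_num)]
    refine le_trans ?_ (Real.sum_le_exp_of_nonneg (by norm_num) 6)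
    norm_num [Finset.sum_range_succ, Nat.factorial]
  have h4 : Real.exp (-1) ≤ 0.368 := by
    rw [Real.exp_neg, inv_le_comm₀ (Real.exp_pos _) (by norm_num)]
    exact le_trans (by norm_num) he.le
  have h5 : Real.exp (-1) / (l + 1) ≤ 0.368 / 1.693 := by
    gcongr
    linarith
  have h6 : (2.718 : ℝ) * (1 - 0.546) ≤
      Real.exp 1 * (1 - Real.exp (-Real.exp (-c * 1))) :=
    mul_le_mul (by linarith) (by linarith) (by norm_num) (Real.exp_pos _).le
  norm_num at h5 h6 ⊢
  linarith

lemma one_add_exp_div_le_of_four_le {l c : ℝ} (hl : 2 * Real.log 2 ≤ l) (hc : c ≤ 1) :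
    1 + Real.exp (-(1 / 8)) / (l + 1 / 8) ≤
      Real.exp 1 * (1 - Real.exp (-Real.exp (-c * (1 / 8)))) := by
  have hlog := Real.log_two_gt_d9
  have he := Real.exp_one_gt_d9
  have h1 : Real.exp (1 / 8) ≤ 1.13315 := by
    refine (Real.exp_bound' (by norm_num) (by norm_num) (n := 5) (by norm_num)).trans ?_
    norm_num [Finset.sum_range_succ, Nat.factorial]
  have h2 : (0.8824 : ℝ) ≤ Real.exp (-c * (1 / 8)) := by
    refine le_trans ?_ (Real.exp_le_exp.2 (show -(1 / 8 : ℝ) ≤ -c * (1 / 8) by linarith))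
    rw [Real.exp_neg, le_inv_comm₀ (by norm_num) (Real.exp_pos _)]
    exact h1.trans (by norm_num)
  have h3 : Real.exp (-Real.exp (-c * (1 / 8))) ≤ 0.414 := by
    refine (Real.exp_le_exp.2 (neg_le_neg h2)).trans ?_
    rw [Real.exp_neg, inv_le_comm₀ (Real.exp_pos _) (by norm_num)]
    refine le_trans ?_ (Real.sum_le_exp_of_nonneg (by norm_num) 8)
    norm_num [Finset.sum_range_succ, Nat.factorial]
  have h4 : Real.exp (-(1 / 8)) ≤ 0.883 := by
    rw [Real.exp_neg, inv_le_comm₀ (Real.exp_pos _) (by norm_num)]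
    refine le_trans ?_ (Real.sum_le_exp_of_nonneg (by norm_num) 4)
    norm_num [Finset.sum_range_succ, Nat.factorial]
  have h5 : Real.exp (-(1 / 8)) / (l + 1 / 8) ≤ 0.883 / 1.511 := by
    gcongr
    linarith
  have h6 : (2.718 : ℝ) * (1 - 0.414) ≤
      Real.exp 1 * (1 - Real.exp (-Real.exp (-c * (1 / 8)))) :=
    mul_le_mul (by linarith) (by linarith) (by norm_num) (Real.exp_pos _).le
  norm_num at h5 h6 ⊢
  linarith

/-- The choice `s = 0` would require `l ≥ 1 / (e - 2)`, slightly more than `2 * log 2`, so a small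
shift `1 / 8` is used for large `l`. For `l ≤ 2 * log 2` the last hypothesis forces `c ≤ 1 / 2`,
which leaves room for `s = 1`. -/
lemma exists_one_add_exp_div_le {l c : ℝ} (hl : Real.log 2 ≤ l) (hc : c ≤ 1)
    (hcl : c * l ≤ l - Real.log 2) :
    ∃ s, 0 ≤ s ∧ 1 + Real.exp (-s) / (l + s) ≤
      Real.exp 1 * (1 - Real.exp (-Real.exp (-c * s))) := by
  have hlog := Real.log_two_gt_d9
  rcases le_total (2 * Real.log 2) l with h | h
  · exact ⟨1 / 8, by norm_num, one_add_exp_div_le_of_four_le h hc⟩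
  · exact ⟨1, zero_le_one, one_add_exp_div_le_of_two_le hl (by nlinarith)⟩

end Numerics

end PostedPrice

namespace PostedPrice

/-! ### Comparison with the benchmark and the competitive ratio. -/

section Main

variable {Ω : Type*} [MeasurableSpace Ω] {P : Measure Ω} [IsProbabilityMeasure P]
  {lam T τ h δ c : ℝ} {ξ : ℝ → ℝ} {W : ℕ → Ω → ℝ}

/-- Density `0` works, since the atom lies outside the set where the distribution function is below
`1`. -/
lemma isMHR_dirac (a : ℝ) : IsMHR ⟨Measure.dirac a, inferInstance⟩ := by
  have hset : {x | cdf (Measure.dirac a) x < 1} = Iio a := by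
    ext x
    have hx : cdf (Measure.dirac a) x = (Iic x).indicator 1 a := by
      rw [cdf_eq_real, measureReal_def, Measure.dirac_apply' _ measurableSet_Iic]
      by_cases hax : a ≤ x <;> simp [hax]
    by_cases hax : a ≤ x
    · simp [hx, hax]
    · simp [hx, hax, not_le.1 hax]
  refine ⟨fun _ => 0, measurable_const, fun _ => le_rfl, ?_, ?_⟩
  · simp only [ProbabilityMeasure.coe_mk, hset]
    simp [restrict_dirac' measurableSet_Iio]
  · simpa using monotoneOn_const

lemma mhrDistributions_nonempty (hh : 1 ≤ h) : (mhrDistributions h).Nonempty :=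
  ⟨⟨Measure.dirac 1, inferInstance⟩, by
    simp [Measure.dirac_apply' _ measurableSet_Icc, hh], isMHR_dirac 1⟩

lemma le_benchmark (hW : IsPoissonArrivals P lam W) (hlam : 0 ≤ lam) (hT : 0 ≤ T)
    (hξ : IsDiscount T ξ) {F : ProbabilityMeasure ℝ} (hF : (F : Measure ℝ) (Icc 1 h) = 1)
    {p : ℝ → ℝ} (hpm : Measurable p) (hp : ∀ t ∈ Icc 0 T, 0 ≤ p t) :
    expectedRevenue P W T ξ F p ≤ benchmark P W T ξ F := by
  have hh : 0 ≤ h := by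
    by_contra! hlt
    rw [Icc_eq_empty (by linarith), measure_empty] at hF
    exact zero_ne_one hF
  have hex : ∫⁻ v, ENNReal.ofReal (max (v - h) 0) ∂(F : Measure ℝ) ≤ ENNReal.ofReal 0 := by
    rw [ENNReal.ofReal_zero, nonpos_iff_eq_zero, lintegral_eq_zero_iff (by fun_prop)]
    filter_upwards [(mem_ae_iff_prob_eq_one measurableSet_Icc).2 hF] with v hv
    simpa using hv.2
  -- With threshold `h` the excess vanishes, so `h` bounds every expected revenue and the supremum
  -- is genuine.
  refine le_csSup ⟨h, ?_⟩ ⟨p, hpm, hp, rfl⟩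
  rintro r ⟨p', -, hp', rfl⟩
  simpa using expectedRevenue_le hW hlam hT hξ hF hp' hh le_rfl hex

lemma benchmark_le_mul_expectedRevenue (hW : IsPoissonArrivals P lam W) (hlam : 0 < lam)
    (hξ : IsDiscount T ξ) {F : ProbabilityMeasure ℝ} (hF : (F : Measure ℝ) (Icc 1 h) = 1)
    (hMHR : IsMHR F) (hδ : 1 < δ) (hh : 1 < h) (hτ : 0 < τ)
    (hT : ((⌊Real.logb δ h⌋₊ : ℝ) + 1) * τ < T) (hc0 : 0 < c) (hc1 : c < 1)
    (hτc : lam * τ = (lam * T) ^ c) (hlog : Real.log 2 ≤ Real.log (lam * T))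
    (hclog : c * Real.log (lam * T) ≤ Real.log (lam * T) - Real.log 2) :
    ξ (((⌊Real.logb δ h⌋₊ : ℝ) + 1) * τ) * c / (δ * Real.exp 1) * benchmark P W T ξ F ≤
      expectedRevenue P W T ξ F (pcPrice T τ h δ ξ) := by
  have hT0 : 0 < T := lt_of_le_of_lt (by positivity) hT
  have hL : 0 < lam * T := by positivity
  have hlog2 : 0 < Real.log 2 := Real.log_pos one_lt_two
  set l := Real.log (lam * T) with hl
  set ξm := ξ (((⌊Real.logb δ h⌋₊ : ℝ) + 1) * τ) with hξm
  have hξm0 : 0 ≤ ξm := hξ.nonneg (by positivity)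
  obtain ⟨s, hs0, hs⟩ := exists_one_add_exp_div_le hlog hc1.le hclog
  have hθ : 0 < l + s := by linarith
  have h0 : survival F 0 = 1 := survival_of_lt_one hF one_pos
  obtain ⟨X, hX1, hXh, hXlow, hXup⟩ := exists_survival_quantile hF (Real.exp_pos (-(l + s)))
    (Real.exp_le_one_iff.2 (by linarith))
  have hX0 : 0 < X := by linarith
  have hB : benchmark P W T ξ F ≤ X * (1 + Real.exp (-s) / (l + s)) := by
    refine csSup_le ⟨_, fun _ => 0, measurable_const, fun _ _ => le_rfl, rfl⟩ ?_
    rintro r ⟨p, -, hp, rfl⟩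
    refine (expectedRevenue_le hW hlam.le hT0.le hξ hF hp hX0.le (by positivity)
      (hMHR.lintegral_excess_le h0 hX0 hθ hXup)).trans_eq ?_
    have : lam * T * Real.exp (-(l + s)) = Real.exp (-s) := by
      rw [neg_add, Real.exp_add, Real.exp_neg l, hl, Real.exp_log hL, ← mul_assoc,
        mul_inv_cancel₀ hL.ne', one_mul]
    rw [← this]
    ring
  set K := 1 - Real.exp (-Real.exp (-c * s)) with hK
  have hK0 : 0 ≤ K := by
    have : Real.exp (-Real.exp (-c * s)) ≤ 1 :=
      Real.exp_le_one_iff.2 (neg_nonpos.2 (Real.exp_pos _).le)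
    linarith
  have hE : ∀ y ∈ Ico 0 X, ξm * (c * y / δ) * K ≤
      expectedRevenue P W T ξ F (pcPrice T τ h δ ξ) := fun y ⟨hy0, hyX⟩ => by
    have hcy : c * y ≤ y := by nlinarith
    refine le_trans ?_ (le_expectedRevenue_pcPrice hW hlam.le hξ hF hδ hh.le hτ hT
      (x := c * y) (by linarith))
    refine mul_le_mul_of_nonneg_left ?_ (by positivity)
    rw [hK, sub_le_sub_iff_left, Real.exp_le_exp, neg_mul, neg_le_neg_iff]
    have h1 : Real.exp (-(l + s)) ^ c ≤ survival F (c * y) :=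
      (Real.rpow_le_rpow (Real.exp_pos _).le (hXlow y hyX) hc0.le).trans
        (hMHR.rpow_survival_le h0 hc0.le hc1.le hy0)
    calc Real.exp (-c * s) = lam * τ * Real.exp (-(l + s)) ^ c := by
          rw [hτc, Real.rpow_def_of_pos hL, ← Real.exp_mul, ← Real.exp_add]
          congr 1
          ring
      _ ≤ _ := mul_le_mul_of_nonneg_left h1 (by positivity)
  -- The quantile bound is available only strictly below `X`, where an atom may sit; hence the limit
  -- `y → X` from the left.
  have hEX : ξm * (c * X / δ) * K ≤ expectedRevenue P W T ξ F (pcPrice T τ h δ ξ) := by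
    have hcont : Filter.Tendsto (fun y => ξm * (c * y / δ) * K) (nhdsWithin X (Iio X))
        (nhds (ξm * (c * X / δ) * K)) :=
      (Continuous.tendsto (by fun_prop) X).mono_left nhdsWithin_le_nhds
    refine le_of_tendsto hcont ?_
    filter_upwards [Ico_mem_nhdsLT hX0] with y hy using hE y hy
  calc ξm * c / (δ * Real.exp 1) * benchmark P W T ξ F
      ≤ ξm * c / (δ * Real.exp 1) * (X * (Real.exp 1 * K)) := by
        refine mul_le_mul_of_nonneg_left (hB.trans ?_) (by positivity)
        exact mul_le_mul_of_nonneg_left hs hX0.le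
    _ = ξm * (c * X / δ) * K := by
        have := Real.exp_pos 1
        field_simp
    _ ≤ _ := hEX

end Main

end PostedPrice

theorem theorem4 {Ω : Type*} [MeasurableSpace Ω] (P : MeasureTheory.Measure Ω)
    [MeasureTheory.IsProbabilityMeasure P]
    (lam T τ ε h δ : ℝ) (ξ : ℝ → ℝ) (W : ℕ → Ω → ℝ)
    (hlam : 0 < lam) (hT : 0 < T)
    (hW : PostedPrice.IsPoissonArrivals P lam W)
    (hξ : PostedPrice.IsDiscount T ξ)
    (hh : 1 < h) (hδ : δ ∈ Set.Ioc 1 h)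
    (hτ : τ ∈ Set.Ioc 0 T) (hε : ε ∈ Set.Ioo (0 : ℝ) 1)
    (hτε : lam * τ = (lam * T) ^ (1 - ε))
    (hbig : 1 - Real.log (Real.exp 1 - 1) ≤ (lam * T) ^ (1 - ε)) :
    ξ (((⌈Real.logb δ h⌉₊ : ℝ) + 1) * (T ^ (1 - ε) * lam ^ (-ε))) * (1 - ε) / (δ * Real.exp 1) ≤
      PostedPrice.competitiveRatio P W T ξ (PostedPrice.mhrDistributions h)
        (PostedPrice.pcPrice T τ h δ ξ) := by
  obtain ⟨hδ1, -⟩ := hδ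
  obtain ⟨hτ0, hτT⟩ := hτ
  obtain ⟨hε0, hε1⟩ := hε
  have hδ0 : 0 < δ := by linarith
  have hL : 0 < lam * T := by positivity
  have hτeq : T ^ (1 - ε) * lam ^ (-ε) = τ := by
    rw [Real.mul_rpow hlam.le hT.le, show (1 : ℝ) - ε = 1 + -ε by ring, Real.rpow_add hlam,
      Real.rpow_one, mul_assoc] at hτε
    rw [mul_left_cancel₀ hlam.ne' hτε, show (1 : ℝ) - ε = 1 + -ε by ring, mul_comm]
  rw [hτeq]
  have : Nonempty (PostedPrice.mhrDistributions h) :=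
    (PostedPrice.mhrDistributions_nonempty hh.le).to_subtype
  refine le_ciInf fun ⟨F, hF, hMHR⟩ => ?_
  have hp0 : ∀ t, 0 ≤ PostedPrice.pcPrice T τ h δ ξ t :=
    PostedPrice.pcPrice_nonneg hξ hτ0 (by linarith) hδ0.le
  have hEB := PostedPrice.le_benchmark hW hlam.le hT.le hξ hF
    (PostedPrice.measurable_pcPrice T τ h δ ξ) fun t _ => hp0 t
  have hE0 : 0 ≤ PostedPrice.expectedRevenue P W T ξ F (PostedPrice.pcPrice T τ h δ ξ) :=
    integral_nonneg_of_ae <| by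
      filter_upwards [PostedPrice.ae_arrivals hW F] with x hx
      exact PostedPrice.revenue_nonneg hx.1 fun t _ _ => hp0 t
  dsimp only
  rcases le_or_gt T (((⌈Real.logb δ h⌉₊ : ℝ) + 1) * τ) with hle | hlt
  · rw [hξ.map_of_ge _ hle, zero_mul, zero_div]
    exact div_nonneg hE0 (hE0.trans hEB)
  have hfc : (⌊Real.logb δ h⌋₊ : ℝ) ≤ ⌈Real.logb δ h⌉₊ := by
    exact_mod_cast Nat.floor_le_ceil _
  have hτm : ((⌊Real.logb δ h⌋₊ : ℝ) + 1) * τ ≤ ((⌈Real.logb δ h⌉₊ : ℝ) + 1) * τ := by gcongr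
  have hceil : (1 : ℝ) ≤ ⌈Real.logb δ h⌉₊ := by
    exact_mod_cast Nat.one_le_ceil_iff.2 (Real.logb_pos hδ1 hh)
  have hclog : (1 - ε) * Real.log (lam * T) ≤ Real.log (lam * T) - Real.log 2 := by
    rw [← Real.log_rpow hL, ← hτε, ← Real.log_div hL.ne' two_ne_zero]
    refine Real.log_le_log (by positivity) ?_
    -- The ceiling is at least `1`, so at least two full intervals fit before `T`.
    have : 2 * τ ≤ T := by nlinarith
    nlinarith
  have hlog2 : 0 < Real.log 2 := Real.log_pos one_lt_two
  have hlog0 : 0 ≤ Real.log (lam * T) := by nlinarith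
  have hlog : Real.log 2 ≤ Real.log (lam * T) := by
    have : 0 ≤ (1 - ε) * Real.log (lam * T) := mul_nonneg (by linarith) hlog0
    linarith
  have key := PostedPrice.benchmark_le_mul_expectedRevenue hW hlam hξ hF hMHR hδ1 hh hτ0
    (hτm.trans_lt hlt) (c := 1 - ε) (by linarith) (by linarith) hτε hlog hclog
  have hξle : ξ (((⌈Real.logb δ h⌉₊ : ℝ) + 1) * τ) ≤ ξ (((⌊Real.logb δ h⌋₊ : ℝ) + 1) * τ) :=
    hξ.antitoneOn_Ici (mem_Ici.2 (by positivity)) (mem_Ici.2 (by positivity)) hτm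
  rcases (hξ.nonneg (t := ((⌈Real.logb δ h⌉₊ : ℝ) + 1) * τ) (by positivity)).eq_or_lt with
    hz | hpos
  · rw [← hz, zero_mul, zero_div]
    exact div_nonneg hE0 (hE0.trans hEB)
  -- Needed to clear the denominator; any threshold in `(0, 1)` has survival `1`, and `1 / 2` is
  -- taken.
  have hEpos : 0 < PostedPrice.expectedRevenue P W T ξ F (PostedPrice.pcPrice T τ h δ ξ) := by
    refine lt_of_lt_of_le ?_ (PostedPrice.le_expectedRevenue_pcPrice hW hlam.le hξ hF hδ1 hh.le hτ0
      (hτm.trans_lt hlt) (x := 1 / 2) (by linarith))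
    rw [PostedPrice.survival_of_lt_one hF (by norm_num), mul_one]
    have h1 : Real.exp (-(lam * τ)) < 1 := Real.exp_lt_one_iff.2 (neg_lt_zero.2 (by positivity))
    exact mul_pos (mul_pos (hpos.trans_le hξle) (by positivity)) (by linarith)
  have hBpos := hEpos.trans_le hEB
  rw [le_div_iff₀ hBpos]
  refine le_trans ?_ key
  have : 0 ≤ 1 - ε := by linarith
  gcongr
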